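/- Let $2^{\mathbb N}$ be the Cantor space, $\mathbb B$ the (countable) Boolean algebra of its clopen subsets, and $H(2^{\mathbb N})$ the group of homeomorphisms of $2^{\mathbb N}$ with the Polish topology induced, via $\varphi\mapsto(U\mapsto\varphi[U])$, from the product $\mathbb B^{\mathbb B}$ of discrete spaces. Let $\mathcal M$ be the standard Borel space of all minimal $\varphi\in H(2^{\mathbb N})$, i.e. those for which no non-empty proper closed set $A\subseteq 2^{\mathbb N}$ satisfies $\varphi[A]=A$, with the Borel structure inherited from $H(2^{\mathbb N})$; every Cantor minimal system is topologically conjugate to one of the form $(2^{\mathbb N},\varphi)$ with $\varphi\in\mathcal M$. For $\varphi,\psi\in\mathcal M$ write $\varphi\cong_{tc}\psi$ if $\pi\circ\varphi=\psi\circ\pi$ for some homeomorphism $\pi$ of $2^{\mathbb N}$ (topological conjugacy). Let $\Delta_{\mathbb R}^+$ be the equivalence relation on $\mathbb R^{\mathbb N}$ given by $x\,\Delta_{\mathbb R}^+\,y\iff\{x_n:n\in\mathbb N\}=\{y_n:n\in\mathbb N\}$. **Theorem.** $\Delta_{\mathbb R}^+$ is Borel reducible to $\cong_{tc}$: there is a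 Borel map $f:\mathbb R^{\mathbb N}\to\mathcal M$ such that for all $x,y\in\mathbb R^{\mathbb N}$, $$x\,\Delta_{\mathbb R}^+\,y\iff f(x)\cong_{tc}f(y).$$ -/

import Mathlib

open Set TopologicalSpace

/-! ### Borel reducibility and the Friedman–Stanley jump -/

/-- `E` is Borel reducible to `F`: there is a Borel map `f` between the underlying standard Borel
spaces with `x E y ↔ f x F f y`. -/
def BorelReducible {X Y : Type*} [MeasurableSpace X] [StandardBorelSpace X]
    [MeasurableSpace Y] [StandardBorelSpace Y] (E : Setoid X) (F : Setoid Y) : Prop :=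
  ∃ f : X → Y, Measurable f ∧ ∀ x y : X, E x y ↔ F (f x) (f y)

/-- The Friedman–Stanley jump `E⁺` of `E`: two sequences are equivalent when they list the same
set of `E`-classes. -/
def friedmanStanleyJump {X : Type*} (E : Setoid X) : Setoid (ℕ → X) where
  r x y := range (fun n => (Quotient.mk E (x n))) = range (fun n => (Quotient.mk E (y n)))
  iseqv := ⟨fun _ => rfl, fun h => h.symm, fun h h' => h.trans h'⟩

/-- The identity relation on `X`. -/
def identityRelation (X : Type*) : Setoid X where
  r x y := x = y
  iseqv := ⟨fun _ => rfl, fun h => h.symm, fun h h' => h.trans h'⟩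

/-! ### Minimality and topological conjugacy -/

/-- The homeomorphism `φ` is minimal: no non-empty proper closed subset `A` satisfies
`φ[A] = A`. -/
def IsMinimalHomeo {X : Type*} [TopologicalSpace X] (φ : X ≃ₜ X) : Prop :=
  ∀ A : Set X, IsClosed A → φ '' A = A → A = ∅ ∨ A = univ

/-- The systems `(X, φ)` and `(Y, ψ)` are topologically conjugate. -/
def TopConjugate {X Y : Type*} [TopologicalSpace X] [TopologicalSpace Y]
    (φ : X ≃ₜ X) (ψ : Y ≃ₜ Y) : Prop :=
  ∃ π : X ≃ₜ Y, ⇑π ∘ ⇑φ = ⇑ψ ∘ ⇑π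

/-! ### The Polish space of homeomorphisms of the Cantor space -/

/-- The Cantor space `2^ℕ` with the product topology. -/
abbrev CantorSpace : Type := ℕ → Bool

/-- The group `H(2^ℕ)` of homeomorphisms of the Cantor space. -/
abbrev CantorHomeo : Type := CantorSpace ≃ₜ CantorSpace

namespace CantorHomeo

/-- The automorphism `U ↦ φ[U]` of the Boolean algebra `𝔹` of clopen subsets of the Cantor
space. -/
def clopenMap (φ : CantorHomeo) (U : Clopens CantorSpace) : Clopens CantorSpace :=
  ⟨φ '' (U : Set CantorSpace), φ.isClosed_image.2 U.isClopen.1, φ.isOpen_image.2 U.isClopen.2⟩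

/-- `H(2^ℕ)` carries the topology induced by `φ ↦ (U ↦ φ[U])` from the product `𝔹^𝔹` of
discrete spaces. -/
instance instTopologicalSpace : TopologicalSpace CantorHomeo :=
  TopologicalSpace.induced clopenMap
    (@Pi.topologicalSpace (Clopens CantorSpace) (fun _ => Clopens CantorSpace) (fun _ => ⊥))

instance instMeasurableSpace : MeasurableSpace CantorHomeo := borel CantorHomeo

instance instBorelSpace : BorelSpace CantorHomeo := ⟨rfl⟩

lemma isOpen_clopenMap_eq (U V : Clopens CantorSpace) :
    IsOpen {φ : CantorHomeo | clopenMap φ U = V} := by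
  let _ : TopologicalSpace (Clopens CantorSpace) := ⊥
  have _ : DiscreteTopology (Clopens CantorSpace) := ⟨rfl⟩
  have h0 : Continuous clopenMap := continuous_induced_dom
  have h : Continuous fun φ : CantorHomeo => clopenMap φ U := (continuous_apply U).comp h0
  exact (isOpen_discrete {V}).preimage h

lemma continuous_eval : Continuous fun p : CantorHomeo × CantorSpace => p.1 p.2 := by
  rw [continuous_iff_continuousAt]
  rintro ⟨φ, x⟩
  refine (isTopologicalBasis_isClopen.nhds_hasBasis (a := φ x)).tendsto_right_iff.2 ?_
  rintro V ⟨hV, hx⟩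
  let U : Clopens CantorSpace := ⟨φ ⁻¹' V, hV.preimage φ.continuous⟩
  have h1 : IsOpen ({ψ : CantorHomeo | clopenMap ψ U = ⟨V, hV⟩} ×ˢ (U : Set CantorSpace)) :=
    (isOpen_clopenMap_eq U _).prod U.isClopen.2
  have h2 : clopenMap φ U = ⟨V, hV⟩ :=
    Clopens.ext (image_preimage_eq V φ.surjective)
  filter_upwards [h1.mem_nhds ⟨h2, hx⟩]
  rintro ⟨ψ, y⟩ ⟨h, hy⟩
  have : (clopenMap ψ U : Set CantorSpace) = V := by rw [show clopenMap ψ U = _ from h]; rfl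
  exact this ▸ mem_image_of_mem ψ hy

lemma continuous_symm : Continuous (Homeomorph.symm : CantorHomeo → CantorHomeo) := by
  let _ : TopologicalSpace (Clopens CantorSpace) := ⊥
  have _ : DiscreteTopology (Clopens CantorSpace) := ⟨rfl⟩
  refine continuous_induced_rng.2 (continuous_pi fun U => continuous_discrete_rng.2 fun V => ?_)
  convert isOpen_clopenMap_eq V U using 1
  ext φ
  simp only [mem_preimage, mem_singleton_iff, mem_ofPred_eq, Function.comp]
  constructor
  · rintro rfl
    refine Clopens.ext ?_
    change _ '' (_ '' _) = _
    simp [image_image]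
  · rintro rfl
    refine Clopens.ext ?_
    change _ '' (_ '' _) = _
    simp [image_image]

/-- The map `φ ↦ (φ, φ⁻¹)`, used to see that `H(2^ℕ)` is Polish. -/
def toPair (φ : CantorHomeo) : C(CantorSpace, CantorSpace) × C(CantorSpace, CantorSpace) :=
  (⟨φ, φ.continuous⟩, ⟨φ.symm, φ.symm.continuous⟩)

lemma isClosedEmbedding_toPair : Topology.IsClosedEmbedding toPair := by
  refine ⟨⟨⟨le_antisymm ?_ ?_⟩, ?_⟩, ?_⟩
  · refine continuous_iff_le_induced.1 (Continuous.prodMk ?_ ?_)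
    · exact ContinuousMap.continuous_of_continuous_uncurry _ continuous_eval
    · exact ContinuousMap.continuous_of_continuous_uncurry _
        (continuous_eval.comp (continuous_symm.prodMap continuous_id))
  · let _ : TopologicalSpace (Clopens CantorSpace) := ⊥
    have _ : DiscreteTopology (Clopens CantorSpace) := ⟨rfl⟩
    refine continuous_iff_le_induced.1 ?_
    let _ : TopologicalSpace CantorHomeo := .induced toPair inferInstance
    have hc : Continuous toPair := continuous_induced_dom
    refine continuous_pi fun U => continuous_discrete_rng.2 fun V => ?_
    have h1 := (ContinuousMap.isOpen_setOfPred_mapsTo (Y := CantorSpace)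
      U.isClopen.1.isCompact V.isClopen.2).preimage (continuous_fst.comp hc)
    have h2 := (ContinuousMap.isOpen_setOfPred_mapsTo (Y := CantorSpace)
      V.isClopen.1.isCompact U.isClopen.2).preimage (continuous_snd.comp hc)
    convert h1.inter h2 using 1
    ext φ
    simp only [mem_preimage, mem_singleton_iff, mem_inter_iff, mem_ofPred_eq, Function.comp]
    constructor
    · rintro rfl
      exact ⟨fun x hx => mem_image_of_mem φ hx, by rintro _ ⟨x, hx, rfl⟩; simpa [toPair] using hx⟩
    · rintro ⟨ha, hb⟩
      refine Clopens.ext (Subset.antisymm (image_subset_iff.2 ha) fun y hy => ?_)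
      exact ⟨φ.symm y, hb hy, by simp⟩
  · intro φ ψ h
    ext x : 1
    exact DFunLike.congr_fun (congrArg Prod.fst h) x
  · have : range toPair = {p | p.1.comp p.2 = ContinuousMap.id _} ∩
        {p | p.2.comp p.1 = ContinuousMap.id _} := by
      ext ⟨f, g⟩
      constructor
      · rintro ⟨φ, h⟩
        rw [← h]
        exact ⟨by ext1 x; simp [toPair], by ext1 x; simp [toPair]⟩
      · rintro ⟨h1, h2⟩
        exact ⟨⟨⟨f, g, DFunLike.congr_fun h2, DFunLike.congr_fun h1⟩, f.continuous, g.continuous⟩,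
          rfl⟩
    rw [this]
    refine (isClosed_eq ?_ continuous_const).inter (isClosed_eq ?_ continuous_const)
    · exact continuous_fst.compCM continuous_snd
    · exact continuous_snd.compCM continuous_fst

lemma polishSpace_continuousMap (X : Type*) [TopologicalSpace X] [CompactSpace X]
    [MetrizableSpace X] : PolishSpace C(X, X) := by
  let _ := metrizableSpaceMetric X
  have : IsCompletelyMetrizableSpace C(X, X) := inferInstance
  exact {}

instance instPolishSpace : PolishSpace CantorHomeo :=
  have := polishSpace_continuousMap CantorSpace
  isClosedEmbedding_toPair.polishSpace

end CantorHomeo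

/-! ### The standard Borel space of Cantor minimal systems -/

/-- The space of minimal homeomorphisms of the Cantor space, with the Borel structure
inherited from `H(2^ℕ)`. -/
def CantorMinimalSystem : Type := {φ : CantorHomeo // IsMinimalHomeo φ}

namespace CantorMinimalSystem

instance instMeasurableSpace : MeasurableSpace CantorMinimalSystem :=
  inferInstanceAs (MeasurableSpace {φ : CantorHomeo // IsMinimalHomeo φ})

lemma continuous_zpow_eval (n : ℤ) :
    Continuous fun p : CantorHomeo × CantorSpace => (p.1 ^ n) p.2 := by
  have key : ∀ m : ℕ, Continuous fun p : CantorHomeo × CantorSpace => (p.1 ^ m) p.2 := by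
    intro m
    induction m with
    | zero => exact continuous_snd
    | succ m ih =>
      simp only [pow_succ']
      exact CantorHomeo.continuous_eval.comp (continuous_fst.prodMk ih)
  obtain ⟨m, rfl | rfl⟩ := n.eq_nat_or_neg
  · simpa only [zpow_natCast] using key m
  · simp only [zpow_neg, zpow_natCast, ← inv_pow]
    exact (key m).comp (CantorHomeo.continuous_symm.prodMap continuous_id)

lemma zpow_mem_of_image_eq {φ : CantorHomeo} {A : Set CantorSpace} (h : φ '' A = A)
    {x : CantorSpace} (hx : x ∈ A) (n : ℤ) : (φ ^ n) x ∈ A := by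
  have h1 : ∀ y ∈ A, φ y ∈ A := fun y hy => h ▸ mem_image_of_mem φ hy
  have h2 : ∀ y ∈ A, (φ⁻¹) y ∈ A := by
    intro y hy
    rw [← h] at hy
    obtain ⟨z, hz, rfl⟩ := hy
    change φ.symm (φ z) ∈ A
    simpa using hz
  have key : ∀ ψ : CantorHomeo, (∀ y ∈ A, ψ y ∈ A) → ∀ m : ℕ, (ψ ^ m) x ∈ A := by
    intro ψ hψ m
    induction m with
    | zero => exact hx
    | succ m ih => rw [pow_succ']; exact hψ _ ih
  obtain ⟨m, rfl | rfl⟩ := n.eq_nat_or_neg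
  · simpa only [zpow_natCast] using key φ h1 m
  · simpa only [zpow_neg, zpow_natCast, ← inv_pow] using key φ⁻¹ h2 m

lemma isMinimalHomeo_iff (φ : CantorHomeo) : IsMinimalHomeo φ ↔
    ∀ U : Clopens CantorSpace, (U : Set CantorSpace).Nonempty → ∀ x, ∃ n : ℤ, (φ ^ n) x ∈ U := by
  constructor
  · intro h U hU x
    let O : Set CantorSpace := range fun n : ℤ => (φ ^ n) x
    have hO : φ '' O = O := by
      refine Subset.antisymm ?_ ?_
      · rintro _ ⟨_, ⟨n, rfl⟩, rfl⟩
        exact ⟨1 + n, by change (φ ^ (1 + n)) x = φ ((φ ^ n) x); rw [zpow_one_add]; rfl⟩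
      · rintro _ ⟨n, rfl⟩
        refine ⟨(φ ^ (n - 1)) x, ⟨n - 1, rfl⟩, ?_⟩
        change (φ * φ ^ (n - 1)) x = (φ ^ n) x
        rw [← zpow_one_add, add_sub_cancel]
    have hx : x ∈ closure O := subset_closure ⟨0, rfl⟩
    rcases h (closure O) isClosed_closure (by rw [φ.image_closure, hO]) with h0 | h1
    · rw [h0] at hx
      exact hx.elim
    · obtain ⟨y, hy⟩ := hU
      have hy' : y ∈ closure O := h1 ▸ mem_univ y
      obtain ⟨_, hz, n, rfl⟩ := mem_closure_iff.1 hy' U U.isClopen.2 hy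
      exact ⟨n, hz⟩
  · intro h A hA hφ
    by_contra! hne
    obtain ⟨x, hx⟩ := hne.1
    obtain ⟨y, hy⟩ := (ne_univ_iff_exists_notMem A).1 hne.2
    obtain ⟨V, hV, hyV, hVA⟩ :=
      isTopologicalBasis_isClopen.exists_subset_of_mem_open (a := y) (u := Aᶜ) hy hA.isOpen_compl
    obtain ⟨n, hn⟩ := h ⟨V, hV⟩ ⟨y, hyV⟩ x
    exact hVA hn (zpow_mem_of_image_eq hφ hx n)

lemma measurableSet_isMinimalHomeo : MeasurableSet {φ : CantorHomeo | IsMinimalHomeo φ} := by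
  have : Countable (Clopens CantorSpace) :=
    Clopens.countable_iff_secondCountable.2 inferInstance
  simp only [isMinimalHomeo_iff, ofPred_forall]
  refine MeasurableSet.iInter fun U => MeasurableSet.iInter fun _ => ?_
  rw [← ofPred_forall]
  refine IsOpen.measurableSet ?_
  have hW : IsOpen {p : CantorHomeo × CantorSpace | ∃ n : ℤ, (p.1 ^ n) p.2 ∈ U} := by
    simp only [ofPred_exists]
    exact isOpen_iUnion fun n => U.isClopen.2.preimage (continuous_zpow_eval n)
  refine isOpen_iff_eventually.2 fun φ hφ => ?_
  have h := (isCompact_univ (X := CantorSpace)).eventually_forall_of_forall_eventually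
    (x₀ := φ) (P := fun φ x => ∃ n : ℤ, (φ ^ n) x ∈ U) fun x _ => hW.mem_nhds (hφ x)
  exact h.mono fun ψ hψ x => hψ x (mem_univ x)

instance instStandardBorelSpace : StandardBorelSpace CantorMinimalSystem :=
  measurableSet_isMinimalHomeo.standardBorel

/-- Topological conjugacy of Cantor minimal systems. -/
def conjugacy : Setoid CantorMinimalSystem where
  r φ ψ := TopConjugate φ.1 ψ.1
  iseqv := by
    refine ⟨fun φ => ⟨Homeomorph.refl _, rfl⟩, ?_, ?_⟩
    · rintro φ ψ ⟨π, h⟩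
      refine ⟨π.symm, funext fun x => π.injective ?_⟩
      simpa using (congrFun h (π.symm x)).symm
    · rintro φ ψ χ ⟨π, h⟩ ⟨ρ, k⟩
      refine ⟨π.trans ρ, funext fun x => ?_⟩
      have h' := congrFun h x
      have k' := congrFun k (π x)
      simp only [Function.comp_apply] at h' k'
      simp [h', k']

end CantorMinimalSystem

/-! A countable set of points `z k` of an odometer, no two distinct ones in one orbit, is coded by
an almost one-to-one extension of the odometer: each point of the orbits of the `z k` is doubled,
and all other fibres are single points. A point over `y` carries bits indexed by `(j, k)`. The bit
is the parity of the first coordinate where `y + j` and `z k` differ, and it is free when they are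
equal. Both parities occur arbitrarily close to `z k`, so both choices are limits along every orbit
and the extension is minimal (`exists_shift_agree`).

The extension depends, up to conjugacy, only on the set of the `z k` (`topConjugate_of_range_eq`).
Conversely, a conjugacy `π` moves odometer coordinates by a constant `c`, since the displacement is
continuous and invariant and the system is minimal. As `π` preserves non-trivial fibres, translation
by `c` carries split orbits to split orbits (`exists_translation`).

It remains to neutralise the unknown `c`. The codes have small digits, and two marker points are
added whose difference occurs for no other pair (`range_subset_of_topConjugate`). This forces `c` to
be an integer, so the set of split orbits, and with it the coded set, is recovered.

The systems live on varying compacta. A canonical homeomorphism onto the Cantor space,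
`branchHomeo`, turns them into points of one space. The result is Borel because everything can be
read off a single dense orbit (`exists_measurable_realization`). -/

/-! ### Minimality and orbits -/

section Orbits

variable {X Y : Type*} [TopologicalSpace X] [TopologicalSpace Y]

lemma Homeomorph.zpow_mem_of_image_eq {T : X ≃ₜ X} {A : Set X} (h : T '' A = A) {x : X}
    (hx : x ∈ A) (n : ℤ) : (T ^ n) x ∈ A := by
  induction n with
  | zero => exact hx
  | succ n ih =>
    rw [add_comm, zpow_one_add]
    exact h ▸ mem_image_of_mem T ih
  | pred n ih =>
    rw [← h] at ih
    obtain ⟨y, hy, hyx⟩ := ih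
    have : (T ^ (-(n : ℤ) - 1)) x = T.symm ((T ^ (-(n : ℤ))) x) := by
      rw [sub_eq_add_neg, add_comm, zpow_add, zpow_neg_one]
      rfl
    rw [this, ← hyx]
    simpa using hy

lemma isMinimalHomeo_of_dense_orbits {T : X ≃ₜ X}
    (h : ∀ x, Dense (range fun n : ℤ => (T ^ n) x)) : IsMinimalHomeo T := by
  intro A hA hTA
  rcases A.eq_empty_or_nonempty with h0 | ⟨x, hx⟩
  · exact Or.inl h0
  · refine Or.inr (eq_univ_of_univ_subset ?_)
    rw [← (h x).closure_eq]
    refine hA.closure_subset_iff.2 ?_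
    rintro _ ⟨n, rfl⟩
    exact Homeomorph.zpow_mem_of_image_eq hTA hx n

lemma IsMinimalHomeo.of_conjugate {T : X ≃ₜ X} (hT : IsMinimalHomeo T) (π : X ≃ₜ Y) :
    IsMinimalHomeo ((π.symm.trans T).trans π) := by
  intro A hA hTA
  have h : T '' (π ⁻¹' A) = π ⁻¹' A := by
    ext x
    constructor
    · rintro ⟨y, hy, rfl⟩
      have h2 : ((π.symm.trans T).trans π) (π y) ∈ A := hTA ▸ mem_image_of_mem _ hy
      simpa using h2
    · intro hx
      change π x ∈ A at hx
      rw [← hTA] at hx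
      obtain ⟨a, ha, hax⟩ := hx
      refine ⟨π.symm a, by simpa using ha, π.injective ?_⟩
      simpa using hax
  rcases hT _ (hA.preimage π.continuous) h with h0 | h1
  · left
    rw [← π.image_preimage A, h0, image_empty]
  · right
    rw [← π.image_preimage A, h1, image_univ, π.surjective.range_eq]

lemma TopConjugate.symm {T : X ≃ₜ X} {S : Y ≃ₜ Y} : TopConjugate T S → TopConjugate S T := by
  rintro ⟨π, h⟩
  refine ⟨π.symm, funext fun x => π.injective ?_⟩
  simpa using (congrFun h (π.symm x)).symm

lemma TopConjugate.trans {Z : Type*} [TopologicalSpace Z] {T : X ≃ₜ X} {S : Y ≃ₜ Y} {R : Z ≃ₜ Z} :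
    TopConjugate T S → TopConjugate S R → TopConjugate T R := by
  rintro ⟨π, h⟩ ⟨ρ, k⟩
  refine ⟨π.trans ρ, funext fun x => ?_⟩
  have h' := congrFun h x
  have k' := congrFun k (π x)
  simp only [Function.comp_apply] at h' k'
  simp [h', k']

/-- A continuous function which is invariant under a minimal homeomorphism is constant. -/
lemma IsMinimalHomeo.eq_of_invariant [T1Space Y] {T : X ≃ₜ X} (hT : IsMinimalHomeo T) {g : X → Y}
    (hg : Continuous g) (hinv : ∀ x, g (T x) = g x) (x y : X) : g x = g y := by
  have hA : T '' (g ⁻¹' {g y}) = g ⁻¹' {g y} := by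
    ext u
    constructor
    · rintro ⟨v, hv, rfl⟩
      exact (hinv v).trans hv
    · intro hu
      refine ⟨T.symm u, ?_, by simp⟩
      have := hinv (T.symm u)
      rw [T.apply_symm_apply] at this
      exact this.symm.trans hu
  rcases hT _ (isClosed_singleton.preimage hg) hA with h0 | h1
  · have : y ∈ g ⁻¹' {g y} := rfl
    rw [h0] at this
    exact this.elim
  · have : x ∈ g ⁻¹' {g y} := h1 ▸ mem_univ x
    exact this

end Orbits

/-! ### Coding a perfect zero-dimensional compactum by its branchings -/

section BranchCode

variable {X : Type*} (c : ℕ → X → Bool)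

/-- The cell of `u` determined by the first `n` bits is split by the `n`-th bit. -/
def IsBranching (u : X) (n : ℕ) : Prop := ∃ v, (∀ i < n, c i v = c i u) ∧ c n v ≠ c n u

/-- The sequence of the bits of `u` at its branchings. -/
noncomputable def branchCode (u : X) (m : ℕ) : Bool := c (Nat.nth (IsBranching c u) m) u

/-- Every cell contains a second point. -/
def CellsNontrivial : Prop := ∀ u N, ∃ v, v ≠ u ∧ ∀ i < N, c i v = c i u

variable {c}

lemma isBranching_congr {u v : X} {n m : ℕ} (h : ∀ i < n, c i v = c i u) (hm : m < n) :
    IsBranching c v m ↔ IsBranching c u m := by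
  have h' : ∀ i < m, c i v = c i u := fun i hi => h i (hi.trans hm)
  constructor <;> rintro ⟨w, hw, hwm⟩
  · exact ⟨w, fun i hi => (hw i hi).trans (h' i hi), by rwa [← h m hm]⟩
  · exact ⟨w, fun i hi => (hw i hi).trans (h' i hi).symm, by rwa [h m hm]⟩

/-- If `u` and `v` also agree at `n`, this is the previous lemma. If they do not, each witnesses the
branching of the other. -/
lemma isBranching_congr' {u v : X} {n : ℕ} (h : ∀ i < n, c i v = c i u) :
    IsBranching c v n ↔ IsBranching c u n := by
  by_cases hn : c n v = c n u
  · exact isBranching_congr (n := n + 1) (fun i hi => by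
      rcases Nat.lt_succ_iff_lt_or_eq.1 hi with h1 | rfl
      · exact h i h1
      · exact hn) n.lt_succ_self
  · exact iff_of_true ⟨u, fun i hi => (h i hi).symm, Ne.symm hn⟩ ⟨v, h, hn⟩

open Classical in
lemma count_isBranching_congr {u v : X} {n : ℕ} (h : ∀ i < n, c i v = c i u) :
    Nat.count (IsBranching c v) n = Nat.count (IsBranching c u) n := by
  induction n with
  | zero => rfl
  | succ n ih =>
    simp only [Nat.count_succ, ih fun i hi => h i (hi.trans n.lt_succ_self),
      isBranching_congr h n.lt_succ_self]

lemma infinite_isBranching (hsep : Function.Injective fun u i => c i u) (hbr : CellsNontrivial c)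
    (u : X) : {n | IsBranching c u n}.Infinite := by
  classical
  refine infinite_of_not_bddAbove ?_
  rintro ⟨N, hN⟩
  obtain ⟨v, hvu, hv⟩ := hbr u (N + 1)
  have hex : ∃ i, c i v ≠ c i u := by
    by_contra! h
    exact hvu (hsep (funext h))
  have h1 := Nat.find_spec hex
  have h2 : IsBranching c u (Nat.find hex) :=
    ⟨v, fun i hi => not_not.1 (Nat.find_min hex hi), h1⟩
  exact h1 (hv _ (Nat.lt_succ_of_le (hN h2)))

lemma nth_isBranching_congr {u v : X} {m : ℕ} (hu : {n | IsBranching c u n}.Infinite)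
    (h : ∀ i < Nat.nth (IsBranching c u) m, c i v = c i u) :
    Nat.nth (IsBranching c v) m = Nat.nth (IsBranching c u) m := by
  classical
  have h1 : IsBranching c v (Nat.nth (IsBranching c u) m) :=
    (isBranching_congr' h).2 (Nat.nth_mem_of_infinite hu m)
  have h2 := Nat.nth_count h1
  rwa [count_isBranching_congr h, Nat.count_nth_of_infinite hu] at h2

lemma branchCode_congr {u v : X} {m : ℕ} (hu : {n | IsBranching c u n}.Infinite)
    (h : ∀ i ≤ Nat.nth (IsBranching c u) m, c i v = c i u) :
    branchCode c v m = branchCode c u m := by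
  rw [branchCode, nth_isBranching_congr hu fun i hi => h i hi.le]
  exact h _ le_rfl

-- Trades `Nat.nth` for a countable union of conditions on counts, whose measurability follows by
-- induction.
open Classical in
lemma branchCode_eq_true_iff {u : X} {m : ℕ} (hu : {n | IsBranching c u n}.Infinite) :
    branchCode c u m = true ↔
      ∃ i, IsBranching c u i ∧ Nat.count (IsBranching c u) i = m ∧ c i u = true := by
  constructor
  · exact fun h => ⟨_, Nat.nth_mem_of_infinite hu m, Nat.count_nth_of_infinite hu m, h⟩
  · rintro ⟨i, hi, rfl, h⟩
    rwa [branchCode, Nat.nth_count hi]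

lemma branchCode_injective (hsep : Function.Injective fun u i => c i u)
    (hbr : CellsNontrivial c) : Function.Injective (branchCode c) := by
  classical
  intro u v huv
  by_contra hne
  have hex : ∃ i, c i v ≠ c i u := by
    by_contra! h
    exact hne (hsep (funext h)).symm
  have hlt : ∀ i < Nat.find hex, c i v = c i u := fun i hi => not_not.1 (Nat.find_min hex hi)
  have hb : IsBranching c u (Nat.find hex) := ⟨v, hlt, Nat.find_spec hex⟩
  have hu := infinite_isBranching hsep hbr u
  have h1 := congrFun huv (Nat.count (IsBranching c u) (Nat.find hex))
  have h2 := Nat.nth_count hb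
  rw [branchCode, branchCode, nth_isBranching_congr (v := v) hu (by rwa [h2]), h2] at h1
  exact Nat.find_spec hex h1.symm

/-- A wrong `m`-th bit is corrected by passing to the other side of the `m`-th branching, which
leaves the earlier bits alone. So the code has dense range, and compactness then gives surjectivity.
-/
lemma exists_branchCode_eq [Nonempty X] (hsep : Function.Injective fun u i => c i u)
    (hbr : CellsNontrivial c) (s : ℕ → Bool) (m : ℕ) :
    ∃ u, ∀ k < m, branchCode c u k = s k := by
  induction m with
  | zero => exact ⟨Classical.arbitrary X, fun k hk => absurd hk (Nat.not_lt_zero k)⟩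
  | succ m ih =>
    obtain ⟨u, hu⟩ := ih
    have hinf := infinite_isBranching hsep hbr u
    by_cases hm : branchCode c u m = s m
    · refine ⟨u, fun k hk => ?_⟩
      rcases Nat.lt_succ_iff_lt_or_eq.1 hk with h | rfl
      exacts [hu k h, hm]
    · obtain ⟨v, hv, hvm⟩ := Nat.nth_mem_of_infinite hinf m
      refine ⟨v, fun k hk => ?_⟩
      rcases Nat.lt_succ_iff_lt_or_eq.1 hk with h | rfl
      · rw [← hu k h]
        exact branchCode_congr hinf fun i hi => hv i (hi.trans_lt (Nat.nth_strictMono hinf h))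
      · rw [branchCode, nth_isBranching_congr hinf hv]
        rw [branchCode] at hm
        revert hvm hm
        cases c (Nat.nth (IsBranching c u) k) v <;> cases c (Nat.nth (IsBranching c u) k) u <;>
          cases s k <;> simp

variable [TopologicalSpace X]

lemma continuous_branchCode (hc : ∀ i, Continuous (c i))
    (hsep : Function.Injective fun u i => c i u) (hbr : CellsNontrivial c) :
    Continuous (branchCode c) := by
  refine continuous_pi fun m => continuous_iff_continuousAt.2 fun u => ?_
  have hu := infinite_isBranching hsep hbr u
  refine (continuousAt_const (y := branchCode c u m)).congr ?_
  have : ∀ᶠ v in nhds u, ∀ i ∈ Iic (Nat.nth (IsBranching c u) m), c i v = c i u :=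
    (Filter.eventually_all_finite (finite_Iic _)).2 fun i _ =>
      (hc i).continuousAt.eventually (isOpen_discrete {c i u} |>.mem_nhds rfl)
  filter_upwards [this] with v hv
  exact (branchCode_congr hu hv).symm

lemma branchCode_surjective [CompactSpace X] [Nonempty X] (hc : ∀ i, Continuous (c i))
    (hsep : Function.Injective fun u i => c i u) (hbr : CellsNontrivial c) :
    Function.Surjective (branchCode c) := by
  have hcont := continuous_branchCode hc hsep hbr
  have hcl : IsClosed (range (branchCode c)) := (isCompact_range hcont).isClosed
  intro s
  choose u hu using fun m => exists_branchCode_eq hsep hbr s m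
  change s ∈ range (branchCode c)
  refine hcl.mem_of_tendsto (f := fun m => branchCode c (u m)) (b := Filter.atTop) ?_
    (Filter.Eventually.of_forall fun m => mem_range_self (u m))
  refine tendsto_pi_nhds.2 fun k => ?_
  refine Filter.Tendsto.congr' ?_ (tendsto_const_nhds (x := s k))
  filter_upwards [Filter.eventually_gt_atTop k] with m hm
  exact (hu m k hm).symm

/-- The branch code is a homeomorphism onto the Cantor space. -/
noncomputable def branchHomeo [CompactSpace X] [Nonempty X] (hc : ∀ i, Continuous (c i))
    (hsep : Function.Injective fun u i => c i u) (hbr : CellsNontrivial c) : X ≃ₜ CantorSpace :=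
  Continuous.homeoOfEquivCompactToT2 (f := Equiv.ofBijective (branchCode c)
    ⟨branchCode_injective hsep hbr, branchCode_surjective hc hsep hbr⟩)
    (continuous_branchCode hc hsep hbr)

end BranchCode

/-! ### Measurable realization on the Cantor space -/

/-- The clopen algebra is countable, so the Borel structure of its power is the product one and can
be tested coordinatewise. -/
lemma measurable_cantorHomeo {P : Type*} [MeasurableSpace P] {f : P → CantorHomeo}
    (hf : ∀ U V, MeasurableSet {p | CantorHomeo.clopenMap (f p) U = V}) : Measurable f := by
  let _ : TopologicalSpace (Clopens CantorSpace) := ⊥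
  have _ : DiscreteTopology (Clopens CantorSpace) := ⟨rfl⟩
  let _ : MeasurableSpace (Clopens CantorSpace) := ⊤
  have _ : Countable (Clopens CantorSpace) :=
    Clopens.countable_iff_secondCountable.2 inferInstance
  have _ : BorelSpace (Clopens CantorSpace) := ⟨borel_eq_top_of_discrete.symm⟩
  have h0 : CantorHomeo.instMeasurableSpace =
      MeasurableSpace.comap CantorHomeo.clopenMap MeasurableSpace.pi := by
    rw [BorelSpace.measurable_eq (α := Clopens CantorSpace → Clopens CantorSpace)]
    exact borel_comap
  rw [h0, measurable_comap_iff]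
  refine measurable_pi_lambda _ fun U => measurable_to_countable' fun V => ?_
  exact hf U V

/-- The condition on `s` is closed, so a dense set suffices. For a countable orbit this is a
countable test. -/
lemma clopenMap_eq_iff {φ : CantorHomeo} {D : Set CantorSpace} (hD : Dense D)
    (U V : Clopens CantorSpace) :
    CantorHomeo.clopenMap φ U = V ↔ ∀ s ∈ D, (s ∈ U ↔ φ s ∈ V) := by
  have h1 : CantorHomeo.clopenMap φ U = V ↔ (U : Set CantorSpace) = φ ⁻¹' V := by
    rw [← SetLike.coe_set_eq]
    change φ '' (U : Set CantorSpace) = V ↔ _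
    constructor
    · intro h
      rw [← h, preimage_image_eq _ φ.injective]
    · intro h
      rw [h, image_preimage_eq _ φ.surjective]
  rw [h1]
  constructor
  · intro h s _
    exact Set.ext_iff.1 h s
  · intro h
    have hW : IsClosed {s | s ∈ U ↔ φ s ∈ V} := by
      have : {s | s ∈ U ↔ φ s ∈ V} = ((U : Set CantorSpace) ∩ φ ⁻¹' V) ∪
          ((U : Set CantorSpace)ᶜ ∩ (φ ⁻¹' V)ᶜ) := by
        ext s
        change (s ∈ U ↔ φ s ∈ V) ↔ (s ∈ U ∧ φ s ∈ V) ∨ (s ∉ U ∧ φ s ∉ V)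
        tauto
      rw [this]
      have hV := V.isClopen.preimage φ.continuous
      exact (U.isClopen.1.inter hV.1).union (U.isClopen.compl.1.inter hV.compl.1)
    ext s
    have : s ∈ closure D := hD s
    exact hW.closure_subset_iff.2 (fun s hs => h s hs) this

theorem exists_measurable_realization {P : Type*} [MeasurableSpace P] (X : P → Type*)
    [∀ p, TopologicalSpace (X p)] [∀ p, CompactSpace (X p)] (T : ∀ p, X p ≃ₜ X p)
    (q : ∀ p, X p) (c : ∀ p, ℕ → X p → Bool) (hc : ∀ p i, Continuous (c p i))
    (hsep : ∀ p, Function.Injective fun u i => c p i u) (hbr : ∀ p, CellsNontrivial (c p))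
    (hmin : ∀ p, IsMinimalHomeo (T p)) (hdense : ∀ p, Dense (range fun n : ℤ => (T p ^ n) (q p)))
    (hmeas : ∀ (n : ℤ) i, Measurable fun p => c p i ((T p ^ n) (q p))) :
    ∃ f : P → CantorMinimalSystem, Measurable f ∧ ∀ p, TopConjugate (T p) (f p).1 := by
  classical
  have hne : ∀ p, Nonempty (X p) := fun p => ⟨q p⟩
  let Φ : ∀ p, X p ≃ₜ CantorSpace := fun p => branchHomeo (hc p) (hsep p) (hbr p)
  let F : P → CantorHomeo := fun p => ((Φ p).symm.trans (T p)).trans (Φ p)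
  let f : P → CantorMinimalSystem := fun p => ⟨F p, (hmin p).of_conjugate (Φ p)⟩
  let o : ∀ p, ℤ → X p := fun p n => (T p ^ n) (q p)
  have ho : ∀ p n, T p (o p n) = o p (n + 1) := by
    intro p n
    change T p ((T p ^ n) (q p)) = (T p ^ (n + 1)) (q p)
    rw [add_comm n, zpow_one_add]
    rfl
  have hset : ∀ n i b, MeasurableSet {p | c p i (o p n) = b} := fun n i b =>
    hmeas n i (measurableSet_singleton b)
  have heq : ∀ n l i, MeasurableSet {p | c p i (o p l) = c p i (o p n)} := fun n l i =>
    measurableSet_eq_fun (hmeas l i) (hmeas n i)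
  have hbrm : ∀ n i, MeasurableSet {p | IsBranching (c p) (o p n) i} := by
    intro n i
    -- The cell in which a witness is sought is open, so a witness may be taken on the dense orbit.
    -- This makes the quantifier countable.
    have : ∀ p, IsBranching (c p) (o p n) i ↔
        ∃ l : ℤ, (∀ j < i, c p j (o p l) = c p j (o p n)) ∧ c p i (o p l) ≠ c p i (o p n) := by
      intro p
      constructor
      · rintro ⟨v, hv, hvi⟩
        have hopen : IsOpen ((⋂ j ∈ Iio i, c p j ⁻¹' {c p j (o p n)}) ∩
            c p i ⁻¹' {c p i (o p n)}ᶜ) :=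
          ((finite_Iio i).isOpen_biInter fun j _ => (isOpen_discrete _).preimage (hc p j)).inter
            ((isOpen_discrete _).preimage (hc p i))
        obtain ⟨_, ⟨h1, h2⟩, l, rfl⟩ := (hdense p).inter_open_nonempty _ hopen
          ⟨v, mem_iInter₂.2 fun j hj => hv j hj, hvi⟩
        exact ⟨l, fun j hj => mem_iInter₂.1 h1 j hj, h2⟩
      · rintro ⟨l, h1, h2⟩
        exact ⟨_, h1, h2⟩
    simp only [this, ofPred_exists]
    refine MeasurableSet.iUnion fun l => ?_
    have h1 : MeasurableSet {p | ∀ j < i, c p j (o p l) = c p j (o p n)} := by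
      simp only [ofPred_forall]
      exact MeasurableSet.iInter fun j => MeasurableSet.iInter fun _ => heq n l j
    exact h1.inter (heq n l i).compl
  have hcount : ∀ n i, Measurable fun p => Nat.count (IsBranching (c p) (o p n)) i := by
    intro n i
    induction i with
    | zero => simp only [Nat.count_zero]; exact measurable_const
    | succ i ih =>
      simp only [Nat.count_succ]
      exact ih.add (Measurable.ite (hbrm n i) measurable_const measurable_const)
  have hcode : ∀ n, Measurable fun p => Φ p (o p n) := by
    intro n
    refine measurable_pi_lambda _ fun m => measurable_to_bool ?_
    change MeasurableSet {p | branchCode (c p) (o p n) m = true}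
    have : ∀ p, branchCode (c p) (o p n) m = true ↔ _ := fun p =>
      branchCode_eq_true_iff (infinite_isBranching (hsep p) (hbr p) (o p n))
    simp only [this, ofPred_exists]
    exact MeasurableSet.iUnion fun i => (hbrm n i).inter
      ((hcount n i (measurableSet_singleton m)).inter (hset n i true))
  have hF : Measurable F := by
    refine measurable_cantorHomeo fun U V => ?_
    have : ∀ p, CantorHomeo.clopenMap (F p) U = V ↔
        ∀ n : ℤ, (Φ p (o p n) ∈ U ↔ Φ p (o p (n + 1)) ∈ V) := by
      intro p
      have hD : Dense (Φ p '' range (o p)) :=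
        (Φ p).surjective.denseRange.dense_image (Φ p).continuous (hdense p)
      rw [clopenMap_eq_iff hD]
      simp only [forall_mem_image, forall_mem_range, F, Homeomorph.trans_apply,
        Homeomorph.symm_apply_apply, ho]
    simp only [this, ofPred_forall]
    refine MeasurableSet.iInter fun n => ?_
    have hU := hcode n U.isClopen.2.measurableSet
    have hV := hcode (n + 1) V.isClopen.2.measurableSet
    exact MeasurableSet.iff hU hV
  exact ⟨f, hF.subtype_mk, fun p => ⟨Φ p, funext fun u => by simp [f, F]⟩⟩

/-! ### An odometer -/

/-- Pairwise coprime moduli, all at least `17`. -/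
def odometerModulus (i : ℕ) : ℕ := Nat.fermatNumber (i + 2)

lemma seventeen_le_odometerModulus (i : ℕ) : 17 ≤ odometerModulus i :=
  Nat.fermatNumber_mono (show 2 ≤ i + 2 by lia)

lemma lt_odometerModulus (i : ℕ) : i < odometerModulus i := by
  have := Nat.fermatNumber_strictMono.le_apply (x := i + 2)
  unfold odometerModulus
  lia

instance (i : ℕ) : NeZero (odometerModulus i) :=
  ⟨by have := seventeen_le_odometerModulus i; lia⟩

instance (i : ℕ) : Fact (1 < odometerModulus i) :=
  ⟨by have := seventeen_le_odometerModulus i; lia⟩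

/-- The product of the cyclic groups `ℤ / m i`, in which the integers are dense. -/
abbrev Odometer : Type := ∀ i : ℕ, ZMod (odometerModulus i)

lemma Odometer.exists_int_eq (g : Odometer) (N : ℕ) : ∃ n : ℤ, ∀ i < N, g i = n := by
  have h := Nat.chineseRemainderOfFinset (fun i => (g i).val) odometerModulus (Finset.range N)
    (fun i _ => NeZero.ne _) (fun i _ j _ hij => by
      refine Nat.coprime_fermatNumber_fermatNumber ?_
      simpa using hij)
  refine ⟨(h.1 : ℕ), fun i hi => ?_⟩
  have := (ZMod.natCast_eq_natCast_iff _ _ _).2 (h.2 i (Finset.mem_range.2 hi))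
  rw [ZMod.natCast_zmod_val] at this
  rw [Int.cast_natCast, this]

/-- The first index of disagreement with an integer can be prescribed: approximate `g` with its
`N`-th coordinate altered. -/
lemma Odometer.exists_int_eq_ne (g : Odometer) (N : ℕ) :
    ∃ n : ℤ, (∀ i < N, g i = n) ∧ g N ≠ n := by
  obtain ⟨n, hn⟩ := Odometer.exists_int_eq (Function.update g N (g N + 1)) (N + 1)
  refine ⟨n, fun i hi => ?_, ?_⟩
  · rw [← hn i (by lia), Function.update_of_ne hi.ne]
  · rw [← hn N (by lia), Function.update_self]
    simp

open Classical in
/-- The parity of the index of the first non-zero coordinate. -/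
noncomputable def firstParity (g : Odometer) : Bool :=
  decide (∃ i, Even i ∧ g i ≠ 0 ∧ ∀ l < i, g l = 0)

lemma firstParity_eq {g : Odometer} {i : ℕ} (hlt : ∀ l < i, g l = 0) (hi : g i ≠ 0) :
    firstParity g = decide (Even i) := by
  refine decide_eq_decide.2 ⟨?_, fun h => ⟨i, h, hi, hlt⟩⟩
  rintro ⟨j, hj, hgj, hj'⟩
  rcases lt_trichotomy i j with h | rfl | h
  · exact absurd (hj' i h) hi
  · exact hj
  · exact absurd (hlt j h) hgj

/-! ### Splitting orbits of the odometer -/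

/-- The odometer with the orbits of the points `z k` doubled. The bit of index `(j, k)` is the
parity of the first index at which `y + j` and `z k` differ, and is free if `y + j = z k`. -/
def splitOdometer (z : ℕ → Odometer) : Set (Odometer × (ℤ × ℕ → Bool)) :=
  {u | (∀ (j : ℤ) k i, (∀ l < i, u.1 l + j = z k l) → u.1 i + j ≠ z k i →
      u.2 (j, k) = decide (Even i)) ∧ ∀ (j : ℤ) k l, z k = z l → u.2 (j, k) = u.2 (j, l)}

namespace splitOdometer

variable (z : ℕ → Odometer)

lemma isClosed : IsClosed (splitOdometer z) := by
  have h1 : ∀ (i : ℕ) (j : ℤ) (a : ZMod (odometerModulus i)),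
      IsClopen {u : Odometer × (ℤ × ℕ → Bool) | u.1 i + j = a} := fun i j a =>
    (isClopen_discrete {b : ZMod (odometerModulus i) | b + j = a}).preimage
      ((continuous_apply i).comp continuous_fst)
  simp only [splitOdometer, ofPred_and, ofPred_forall]
  refine IsClosed.inter ?_ ?_
  · refine isClosed_iInter fun j => isClosed_iInter fun k => isClosed_iInter fun i => ?_
    refine isClosed_imp ?_ (isClosed_imp ?_ ?_)
    · simp only [ofPred_forall]
      exact (finite_Iio i).isOpen_biInter fun l _ => (h1 l j (z k l)).2
    · exact (h1 i j (z k i)).compl.2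
    · exact isClosed_eq ((continuous_apply _).comp continuous_snd) continuous_const
  · refine isClosed_iInter fun j => isClosed_iInter fun k => isClosed_iInter fun l =>
      isClosed_iInter fun _ => ?_
    exact isClosed_eq ((continuous_apply _).comp continuous_snd)
      ((continuous_apply _).comp continuous_snd)

instance : CompactSpace (splitOdometer z) :=
  isCompact_iff_compactSpace.1 (isClosed z).isCompact

/-- Addition of `1` on the odometer, lifted to the split odometer. -/
def shift : splitOdometer z ≃ₜ splitOdometer z where
  toFun u := ⟨(u.1.1 + 1, fun p => u.1.2 (p.1 + 1, p.2)), by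
    refine ⟨fun j k i h1 h2 => u.2.1 (j + 1) k i (fun l hl => ?_) ?_,
      fun j k l h => u.2.2 (j + 1) k l h⟩
    · rw [← h1 l hl]
      change _ = u.1.1 l + 1 + (j : ZMod _)
      push_cast
      ring
    · convert h2 using 1
      change _ = u.1.1 i + 1 + (j : ZMod _)
      push_cast
      ring⟩
  invFun u := ⟨(u.1.1 - 1, fun p => u.1.2 (p.1 - 1, p.2)), by
    refine ⟨fun j k i h1 h2 => u.2.1 (j - 1) k i (fun l hl => ?_) ?_,
      fun j k l h => u.2.2 (j - 1) k l h⟩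
    · rw [← h1 l hl]
      change _ = u.1.1 l - 1 + (j : ZMod _)
      push_cast
      ring
    · convert h2 using 1
      change _ = u.1.1 i - 1 + (j : ZMod _)
      push_cast
      ring⟩
  left_inv u := by
    refine Subtype.ext (Prod.ext ?_ ?_)
    · simp
    · simp
  right_inv u := by
    refine Subtype.ext (Prod.ext ?_ ?_)
    · simp
    · simp
  continuous_toFun := by
    refine Continuous.subtype_mk (Continuous.prodMk ?_ (continuous_pi fun p => ?_)) _
    · fun_prop
    · exact (continuous_apply (A := fun _ => Bool) (p.1 + 1, p.2)).comp
        (continuous_snd.comp continuous_subtype_val)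
  continuous_invFun := by
    refine Continuous.subtype_mk (Continuous.prodMk ?_ (continuous_pi fun p => ?_)) _
    · fun_prop
    · exact (continuous_apply (A := fun _ => Bool) (p.1 - 1, p.2)).comp
        (continuous_snd.comp continuous_subtype_val)

variable {z}

lemma shift_zpow (u : splitOdometer z) (n : ℤ) :
    ((shift z ^ n) u).1 = (u.1.1 + (n : Odometer), fun p => u.1.2 (p.1 + n, p.2)) := by
  -- One equivalence serves both the forward and the backward step of the integer induction.
  have key : ∀ (m : ℤ) (v : splitOdometer z), (shift z v).1 =
      (u.1.1 + (m : Odometer), fun p => u.1.2 (p.1 + m, p.2)) ↔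
      v.1 = (u.1.1 + ((m - 1 : ℤ) : Odometer), fun p => u.1.2 (p.1 + (m - 1), p.2)) := by
    intro m v
    change (v.1.1 + 1, fun p : ℤ × ℕ => v.1.2 (p.1 + 1, p.2)) = _ ↔ _
    rw [Prod.ext_iff, Prod.ext_iff]
    refine and_congr ?_ ?_
    · change v.1.1 + 1 = u.1.1 + (m : Odometer) ↔ v.1.1 = u.1.1 + ((m - 1 : ℤ) : Odometer)
      rw [Int.cast_sub, Int.cast_one, ← add_sub_assoc, eq_sub_iff_add_eq]
    · constructor
      · intro h
        funext p
        have := congrFun h (p.1 - 1, p.2)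
        simp only [sub_add_cancel] at this
        exact this.trans (congrArg u.1.2 (Prod.ext (by ring) rfl))
      · intro h
        funext p
        have := congrFun h (p.1 + 1, p.2)
        exact this.trans (congrArg u.1.2 (Prod.ext (by ring) rfl))
  induction n with
  | zero => simp
  | succ n ih =>
    rw [add_comm, zpow_one_add]
    refine (key _ _).2 ?_
    rw [add_sub_cancel_left]
    exact ih
  | pred n ih =>
    refine (key _ _).1 ?_
    rw [← ih, show (-(n : ℤ)) = 1 + (-(n : ℤ) - 1) by ring, zpow_one_add]
    simp only [add_sub_cancel_left]
    rfl

open Classical in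
variable (z) in
/-- A point over `y`; its bits are `b` where they are free. -/
noncomputable def point (y : Odometer) (b : Bool) : splitOdometer z :=
  ⟨(y, fun p => if y + (p.1 : Odometer) = z p.2 then b
      else firstParity (y + (p.1 : Odometer) - z p.2)), by
    constructor
    · intro j k i h1 h2
      have hne : y + (j : Odometer) ≠ z k := fun h => h2 (congrFun h i)
      dsimp only
      rw [if_neg hne]
      exact firstParity_eq (fun l hl => sub_eq_zero.2 (h1 l hl)) (sub_ne_zero.2 h2)
    · intro j k l h
      dsimp only
      rw [h]⟩

/-- Off the point `z k`, finitely many odometer coordinates determine the bit. -/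
lemma bit_eq {u v : splitOdometer z} {j : ℤ} {k N : ℕ} (h : ∀ l < N, u.1.1 l = v.1.1 l)
    (hN : ∃ i < N, u.1.1 i + j ≠ z k i) : u.1.2 (j, k) = v.1.2 (j, k) := by
  classical
  have hs := Nat.find_spec hN
  have hm : ∀ l < Nat.find hN, u.1.1 l + j = z k l := by
    intro l hl
    by_contra hne
    exact Nat.find_min hN hl ⟨hl.trans hs.1, hne⟩
  rw [u.2.1 j k _ hm hs.2]
  refine (v.2.1 j k _ (fun l hl => ?_) ?_).symm
  · rw [← h l (hl.trans hs.1), hm l hl]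
  · rw [← h _ hs.1]
    exact hs.2

/-- The fibres over the split orbits are the non-trivial ones. -/
lemma exists_ne_iff (y : Odometer) : (∃ u v : splitOdometer z, u ≠ v ∧ u.1.1 = y ∧ v.1.1 = y) ↔
    ∃ (j : ℤ) (k : ℕ), y + (j : Odometer) = z k := by
  constructor
  · rintro ⟨u, v, hne, rfl, hv⟩
    by_contra! h
    refine hne (Subtype.ext (Prod.ext hv.symm (funext fun p => ?_)))
    obtain ⟨i, hi⟩ := Function.ne_iff.1 (h p.1 p.2)
    exact bit_eq (N := i + 1) (fun l _ => congrFun hv.symm l) ⟨i, by lia, hi⟩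
  · rintro ⟨j, k, h⟩
    refine ⟨point z y true, point z y false, fun heq => ?_, rfl, rfl⟩
    have := congrFun (congrArg (fun u => u.1.2) heq) (j, k)
    simp [point, h] at this

/-! ### Minimality of the split odometer -/

/-- The points `z k` lie in the same orbit only if they are equal. -/
def Separated (z : ℕ → Odometer) : Prop := ∀ k l (n : ℤ), z k = z l + (n : Odometer) → n = 0

/-- Separation allows only one `j`, and bits at equal `z k` coincide, so there is a single free
choice in each fibre. -/
lemma exists_free_bit (hz : Separated z) (v : splitOdometer z) :
    ∃ b, ∀ (j : ℤ) k, v.1.1 + (j : Odometer) = z k → v.1.2 (j, k) = b := by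
  by_cases h : ∃ (j : ℤ) (k : ℕ), v.1.1 + (j : Odometer) = z k
  · obtain ⟨j, k, h⟩ := h
    refine ⟨v.1.2 (j, k), fun i l hl => ?_⟩
    have h0 := hz l k (i - j) (by rw [← h, ← hl]; push_cast; ring)
    obtain rfl : i = j := by lia
    exact v.2.2 i l k (hl.symm.trans h)
  · push Not at h
    exact ⟨true, fun j k hjk => absurd hjk (h j k)⟩

/-- The shift is chosen so that the odometer coordinates first disagree at a large `K` whose parity
is the free bit of `v`. Free bits then match by parity, and the other bits in `s` are already
decided before `K`. The disagreement at `K` keeps the points distinct, so the case `u = v` shows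
that cells are non-trivial. -/
lemma exists_shift_agree (hz : Separated z) (u v : splitOdometer z) (N : ℕ)
    (s : Finset (ℤ × ℕ)) : ∃ n : ℤ, (shift z ^ n) u ≠ v ∧
      (∀ i < N, ((shift z ^ n) u).1.1 i = v.1.1 i) ∧
      ∀ p ∈ s, ((shift z ^ n) u).1.2 p = v.1.2 p := by
  have hM : ∀ p : ℤ × ℕ, ∃ M, v.1.1 + (p.1 : Odometer) ≠ z p.2 →
      ∃ i < M, v.1.1 i + p.1 ≠ z p.2 i := by
    intro p
    by_cases h : v.1.1 + (p.1 : Odometer) = z p.2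
    · exact ⟨0, fun h' => absurd h h'⟩
    · obtain ⟨i, hi⟩ := Function.ne_iff.1 h
      exact ⟨i + 1, fun _ => ⟨i, by lia, hi⟩⟩
  choose M hM using hM
  obtain ⟨b, hb⟩ := exists_free_bit hz v
  -- The bound or its successor has the required parity.
  obtain ⟨K, hK, hKb⟩ : ∃ K, max N (s.sup M) ≤ K ∧ decide (Even K) = b := by
    by_cases h : decide (Even (max N (s.sup M))) = b
    · exact ⟨_, le_rfl, h⟩
    · refine ⟨max N (s.sup M) + 1, by lia, ?_⟩
      revert h
      cases b <;> simp [Nat.even_add_one]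
  obtain ⟨n, hn, hnK⟩ := Odometer.exists_int_eq_ne (v.1.1 - u.1.1) K
  have hy : ∀ i, ((shift z ^ n) u).1.1 i = u.1.1 i + n := fun i => by rw [shift_zpow]; rfl
  have hlt : ∀ i < K, ((shift z ^ n) u).1.1 i = v.1.1 i := fun i hi => by
    rw [hy, ← hn i hi]
    simp
  have hKne : ((shift z ^ n) u).1.1 K ≠ v.1.1 K := fun h => hnK (by
    rw [Pi.sub_apply, ← h, hy, add_sub_cancel_left])
  refine ⟨n, fun h => hKne (by rw [h]), fun i hi => hlt i (by lia), fun p hp => ?_⟩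
  by_cases hv : v.1.1 + (p.1 : Odometer) = z p.2
  · have hv' : ∀ i, v.1.1 i + p.1 = z p.2 i := congrFun hv
    rw [show v.1.2 p = b from hb p.1 p.2 hv, ← hKb]
    refine ((shift z ^ n) u).2.1 p.1 p.2 K (fun l hl => ?_) fun h => hKne ?_
    · rw [hlt l hl, hv']
    · exact add_right_cancel (h.trans (hv' K).symm)
  · obtain ⟨i, hi, hne⟩ := hM p hv
    have : M p ≤ s.sup M := Finset.le_sup hp
    exact (bit_eq (N := K) (fun l hl => (hlt l hl).symm) ⟨i, by lia, hne⟩).symm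

/-- The bits of a point of the split odometer: those of its odometer coordinates in unary and
those recording the splitting. -/
def bit (a : (ℕ × ℕ) ⊕ (ℤ × ℕ)) (u : splitOdometer z) : Bool :=
  a.elim (fun a => decide (u.1.1 a.1 = (a.2 : ZMod _))) u.1.2

variable (z) in
/-- An enumeration of the bits. -/
def coord (n : ℕ) : splitOdometer z → Bool := bit (Denumerable.ofNat ((ℕ × ℕ) ⊕ (ℤ × ℕ)) n)

lemma continuous_bit (a : (ℕ × ℕ) ⊕ (ℤ × ℕ)) : Continuous (bit (z := z) a) := by
  rcases a with a | p
  · exact (continuous_of_discreteTopology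
      (f := fun b : ZMod (odometerModulus a.1) => decide (b = (a.2 : ZMod _)))).comp
      ((continuous_apply a.1).comp (continuous_fst.comp continuous_subtype_val))
  · exact (continuous_apply p).comp (continuous_snd.comp continuous_subtype_val)

lemma coord_injective : Function.Injective fun (u : splitOdometer z) n => coord z n u := by
  intro u v h
  have hb : ∀ a, bit a u = bit a v := by
    intro a
    have := congrFun h (Encodable.encode a)
    simpa [coord] using this
  refine Subtype.ext (Prod.ext (funext fun i => ?_) (funext fun p => hb (Sum.inr p)))
  have := hb (Sum.inl (i, (v.1.1 i).val))
  simpa [bit] using this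

lemma exists_shift_coord_agree (hz : Separated z) (u v : splitOdometer z) (N : ℕ) :
    ∃ n : ℤ, (shift z ^ n) u ≠ v ∧ ∀ i < N, coord z i ((shift z ^ n) u) = coord z i v := by
  let e := Denumerable.ofNat ((ℕ × ℕ) ⊕ (ℤ × ℕ))
  obtain ⟨n, hne, h1, h2⟩ := exists_shift_agree hz u v
    ((Finset.range N).sup fun i => (e i).elim (fun a => a.1 + 1) fun _ => 0)
    ((Finset.range N).biUnion fun i => (e i).elim (fun _ => ∅) fun p => {p})
  refine ⟨n, hne, fun i hi => ?_⟩
  have hle := Finset.le_sup (f := fun i => (e i).elim (fun a => a.1 + 1) fun _ => 0)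
    (Finset.mem_range.2 hi)
  have hmem := Finset.subset_biUnion_of_mem
    (fun i => (e i).elim (fun _ => (∅ : Finset (ℤ × ℕ))) fun p => {p}) (Finset.mem_range.2 hi)
  change bit (e i) _ = bit (e i) _
  rcases hei : e i with a | p
  · simp only [hei, Sum.elim_inl] at hle
    simp only [bit, Sum.elim_inl, h1 a.1 (by lia)]
  · simp only [hei, Sum.elim_inr] at hmem
    exact h2 p (hmem (Finset.mem_singleton_self p))

lemma dense_orbit (hz : Separated z) (u : splitOdometer z) :
    Dense (range fun n : ℤ => (shift z ^ n) u) := by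
  intro v
  have hemb : Topology.IsInducing fun (u : splitOdometer z) n => coord z n u :=
    (Continuous.isClosedEmbedding (continuous_pi fun n => continuous_bit _)
      coord_injective).isInducing
  choose n _ hn using exists_shift_coord_agree hz u v
  refine mem_closure_of_tendsto (f := fun N => (shift z ^ n N) u) (b := Filter.atTop) ?_
    (Filter.Eventually.of_forall fun N => ⟨n N, rfl⟩)
  refine hemb.tendsto_nhds_iff.2 (tendsto_pi_nhds.2 fun k => ?_)
  refine Filter.Tendsto.congr' ?_ (tendsto_const_nhds (x := coord z k v))
  filter_upwards [Filter.eventually_gt_atTop k] with N hN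
  exact (hn N k hN).symm

lemma isMinimalHomeo_shift (hz : Separated z) : IsMinimalHomeo (shift z) :=
  isMinimalHomeo_of_dense_orbits (dense_orbit hz)

lemma cellsNontrivial_coord (hz : Separated z) : CellsNontrivial (coord z) := fun u N =>
  let ⟨n, h⟩ := exists_shift_coord_agree hz u u N
  ⟨(shift z ^ n) u, h⟩

/-! ### Conjugacy of split odometers -/

/-- Reindexing the bits gives maps in both directions. They are mutually inverse because bits at
equal `z k` coincide, which is the role of the second clause of `splitOdometer`. -/
lemma topConjugate_of_range_eq {z' : ℕ → Odometer} (h : range z = range z') :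
    TopConjugate (shift z) (shift z') := by
  have reindex : ∀ {z z' : ℕ → Odometer} {σ : ℕ → ℕ} (_ : ∀ k, z (σ k) = z' k)
      (u : splitOdometer z), (u.1.1, fun p : ℤ × ℕ => u.1.2 (p.1, σ p.2)) ∈ splitOdometer z' := by
    intro z z' σ hσ u
    refine ⟨fun j k i h1 h2 => u.2.1 j (σ k) i (by simpa [hσ] using h1) (by simpa [hσ] using h2),
      fun j k l hkl => u.2.2 j _ _ (by simpa [hσ] using hkl)⟩
  have cont : ∀ {z z' : ℕ → Odometer} {σ : ℕ → ℕ} (hσ : ∀ k, z (σ k) = z' k),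
      Continuous fun u : splitOdometer z => (⟨_, reindex hσ u⟩ : splitOdometer z') := by
    intro z z' σ hσ
    refine Continuous.subtype_mk (Continuous.prodMk ?_ (continuous_pi fun p => ?_)) _
    · exact continuous_fst.comp continuous_subtype_val
    · exact (continuous_apply (A := fun _ => Bool) (p.1, σ p.2)).comp
        (continuous_snd.comp continuous_subtype_val)
  have h1 : ∀ k, ∃ l, z l = z' k := fun k => h.ge (mem_range_self k)
  have h2 : ∀ k, ∃ l, z' l = z k := fun k => h.le (mem_range_self k)
  choose σ hσ using h1
  choose τ hτ using h2
  refine ⟨⟨⟨fun u => ⟨_, reindex hσ u⟩, fun u => ⟨_, reindex hτ u⟩, fun u => ?_, fun u => ?_⟩,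
    cont hσ, cont hτ⟩, rfl⟩
  · exact Subtype.ext (Prod.ext rfl (funext fun p => u.2.2 _ _ _ (by rw [hσ, hτ])))
  · exact Subtype.ext (Prod.ext rfl (funext fun p => u.2.2 _ _ _ (by rw [hτ, hσ])))

/-- A conjugacy translates the set of split orbits. -/
lemma exists_translation {z' : ℕ → Odometer} (hz : Separated z)
    (h : TopConjugate (shift z) (shift z')) : ∃ c : Odometer, ∀ y,
      (∃ (j : ℤ) (k : ℕ), y + (j : Odometer) = z k) ↔
        ∃ (j : ℤ) (k : ℕ), y + c + (j : Odometer) = z' k := by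
  obtain ⟨π, hπ⟩ := h
  -- Both shifts add `1` to the odometer coordinate, so the displacement is invariant, hence
  -- constant.
  let g : splitOdometer z → Odometer := fun u => (π u).1.1 - u.1.1
  have hg : Continuous g :=
    (continuous_fst.comp (continuous_subtype_val.comp π.continuous)).sub
      (continuous_fst.comp continuous_subtype_val)
  have hinv : ∀ u, g (shift z u) = g u := by
    intro u
    have h1 : π (shift z u) = shift z' (π u) := congrFun hπ u
    change (π (shift z u)).1.1 - (u.1.1 + 1) = (π u).1.1 - u.1.1
    rw [h1]
    change (π u).1.1 + 1 - (u.1.1 + 1) = (π u).1.1 - u.1.1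
    ring
  have hc : ∀ u, (π u).1.1 = u.1.1 + g (point z 0 true) := fun u => by
    rw [← (isMinimalHomeo_shift hz).eq_of_invariant hg hinv u]
    simp [g]
  refine ⟨g (point z 0 true), fun y => ?_⟩
  -- Lying on a split orbit means having a fibre with two points, a property that the bijection `π`
  -- transports.
  rw [← exists_ne_iff, ← exists_ne_iff]
  constructor
  · rintro ⟨u, v, hne, hu, hv⟩
    exact ⟨π u, π v, π.injective.ne hne, by rw [hc, hu], by rw [hc, hv]⟩
  · rintro ⟨u, v, hne, hu, hv⟩
    obtain ⟨u, rfl⟩ := π.surjective u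
    obtain ⟨v, rfl⟩ := π.surjective v
    rw [hc] at hu hv
    exact ⟨u, v, fun h => hne (congrArg π h), add_right_cancel hu, add_right_cancel hv⟩

end splitOdometer

/-! ### Coding countable sets of reals by split orbits -/

/-- The point of the odometer with given residues. -/
def Odometer.ofDigits (d : ℕ → ℤ) : Odometer := fun i => (d i : ZMod (odometerModulus i))

/-- At a modulus exceeding `|n| + 8` the congruence is an equality, so `|n| ≤ 8`. Then `n - t i` is
at most `16` in absolute value, less than every modulus. -/
lemma Odometer.eq_of_bounded {t : ℕ → ℤ} {n : ℤ} (ht : ∀ i, |t i| ≤ 8)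
    (h : ∀ i, (t i : ZMod (odometerModulus i)) = n) (i : ℕ) : t i = n := by
  have key : ∀ i, |n| + 8 < odometerModulus i → t i = n := by
    intro i hi
    have h1 := (ZMod.intCast_eq_intCast_iff_dvd_sub _ _ _).1 (h i)
    have h2 := Int.eq_zero_of_abs_lt_dvd h1 (by
      have h3 := abs_sub n (t i)
      have h4 := ht i
      lia)
    lia
  have hn : |n| ≤ 8 := by
    rw [← key (n.natAbs + 8) (by
      have := lt_odometerModulus (n.natAbs + 8)
      have := Int.natCast_natAbs n
      lia)]
    exact ht _
  exact key i (by have := seventeen_le_odometerModulus i; lia)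

/-- The digits of the points to be split: a base point, a second point at a distance from it not
occurring elsewhere, and the points coding the members of the given sequence. -/
def codeDigits (x : ℕ → ℕ → Bool) : ℕ → ℕ → ℤ
  | 0, _ => 0
  | 1, 1 => 3
  | 1, _ => 0
  | _ + 2, 0 => 0
  | _ + 2, 1 => 1
  | k + 2, i + 2 => (x k i).toNat

/-- The points of the odometer coding the members of a sequence. -/
def codePoints (x : ℕ → ℕ → Bool) (k : ℕ) : Odometer := .ofDigits (codeDigits x k)

lemma codeDigits_zero (x : ℕ → ℕ → Bool) (k : ℕ) : codeDigits x k 0 = 0 := by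
  rcases k with _ | _ | k <;> rfl

lemma codeDigits_mem (x : ℕ → ℕ → Bool) (k i : ℕ) :
    0 ≤ codeDigits x k i ∧ codeDigits x k i ≤ 3 := by
  rcases k with _ | _ | k <;> rcases i with _ | _ | i <;> simp [codeDigits]
  cases x k i <;> simp

/-- Digit differences are small, so they all equal `n`. The digit of index `0`, common to all codes,
makes `n` vanish. -/
lemma codeDigits_eq_of_add_eq {x x' : ℕ → ℕ → Bool} {k l : ℕ} {n : ℤ}
    (h : codePoints x k + (n : Odometer) = codePoints x' l) :
    n = 0 ∧ codeDigits x k = codeDigits x' l := by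
  have h1 := Odometer.eq_of_bounded (t := fun i => codeDigits x' l i - codeDigits x k i) (n := n)
    (fun i => by
      have := codeDigits_mem x k i
      have := codeDigits_mem x' l i
      rw [abs_le]
      lia)
    (fun i => by
      have := congrFun h i
      change (codeDigits x k i : ZMod (odometerModulus i)) + n = codeDigits x' l i at this
      push_cast
      rw [← this]
      ring)
  have h0 : n = 0 := by
    have := h1 0
    simp only [codeDigits_zero] at this
    lia
  refine ⟨h0, funext fun i => ?_⟩
  have := h1 i
  lia

lemma separated_codePoints (x : ℕ → ℕ → Bool) : splitOdometer.Separated (codePoints x) :=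
  fun _ _ _ h => (codeDigits_eq_of_add_eq h.symm).1

lemma range_codePoints_subset {x x' : ℕ → ℕ → Bool} (h : range x ⊆ range x') :
    range (codePoints x) ⊆ range (codePoints x') := by
  rintro _ ⟨k, rfl⟩
  rcases k with _ | _ | k
  · exact ⟨0, rfl⟩
  · refine ⟨1, congrArg Odometer.ofDigits (funext fun i => ?_)⟩
    rcases i with _ | _ | i <;> rfl
  · obtain ⟨l, hl⟩ := h ⟨k, rfl⟩
    refine ⟨l + 2, congrArg Odometer.ofDigits (funext fun i => ?_)⟩
    rcases i with _ | _ | i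
    · rfl
    · rfl
    · simp only [codeDigits, hl]

lemma range_subset_of_topConjugate {x x' : ℕ → ℕ → Bool}
    (h : TopConjugate (splitOdometer.shift (codePoints x)) (splitOdometer.shift (codePoints x'))) :
    range x ⊆ range x' := by
  obtain ⟨c, hc⟩ := splitOdometer.exists_translation (separated_codePoints x) h
  obtain ⟨j, k, hk⟩ := (hc (codePoints x 0)).1 ⟨0, 0, by simp⟩
  obtain ⟨j', k', hk'⟩ := (hc (codePoints x 1)).1 ⟨0, 1, by simp⟩
  have hc' : ∀ i, (c i : ZMod (odometerModulus i)) + j = codeDigits x' k i := fun i => by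
    have := congrFun hk i
    change ((codeDigits x 0 i : ℤ) : ZMod (odometerModulus i)) + c i + j = codeDigits x' k i at this
    simpa [codeDigits] using this
  -- Subtracting the relations for the two markers eliminates `c` and leaves an identity between
  -- bounded digits.
  have h1 := Odometer.eq_of_bounded
    (t := fun i => codeDigits x' k' i - codeDigits x' k i - codeDigits x 1 i) (n := j' - j)
    (fun i => by
      have := codeDigits_mem x' k' i
      have := codeDigits_mem x' k i
      have := codeDigits_mem x 1 i
      rw [abs_le]
      lia)
    (fun i => by
      have := congrFun hk' i
      change ((codeDigits x 1 i : ℤ) : ZMod (odometerModulus i)) + c i + j' =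
        codeDigits x' k' i at this
      push_cast
      rw [← this, ← hc' i]
      ring)
  -- Index `0` gives `j' = j`. At index `1` the images of the markers differ by `3`, the maximal
  -- digit, so the image of the base point has digit `0` there and is not a code; the second marker
  -- has digit `3`.
  have hk0 : k = 0 := by
    have e0 := h1 0
    have e1 := h1 1
    simp only [codeDigits_zero] at e0
    rcases k with _ | _ | k
    · rfl
    · have := (codeDigits_mem x' k' 1).2
      simp only [codeDigits] at e1
      lia
    · have := (codeDigits_mem x' k' 1).2
      simp only [codeDigits] at e1
      lia
  subst hk0
  -- Thus `c` is the integer `-j`, and translation by it preserves orbits.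
  have hcj : c + (j : Odometer) = 0 := funext fun i => by
    simpa [codeDigits] using hc' i
  rintro _ ⟨m, rfl⟩
  obtain ⟨i, l, hl⟩ := (hc (codePoints x (m + 2))).1 ⟨0, m + 2, by simp⟩
  have hl' : codePoints x (m + 2) + ((i - j : ℤ) : Odometer) = codePoints x' l := by
    rw [← hl, eq_neg_of_add_eq_zero_left hcj]
    push_cast
    ring
  have hd := (codeDigits_eq_of_add_eq hl').2
  -- The digit of index `1` is `1` for codes but `0` and `3` for the markers, so a code can only go
  -- to a code.
  rcases l with _ | _ | l
  · simpa [codeDigits] using congrFun hd 1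
  · simpa [codeDigits] using congrFun hd 1
  · refine ⟨l, funext fun i => ?_⟩
    have := congrFun hd (i + 2)
    simp only [codeDigits] at this
    revert this
    cases x m i <;> cases x' l i <;> simp

lemma topConjugate_shift_codePoints_iff {x x' : ℕ → ℕ → Bool} :
    TopConjugate (splitOdometer.shift (codePoints x)) (splitOdometer.shift (codePoints x')) ↔
      range x = range x' :=
  ⟨fun h => (range_subset_of_topConjugate h).antisymm (range_subset_of_topConjugate h.symm),
    fun h => splitOdometer.topConjugate_of_range_eq
      ((range_codePoints_subset h.subset).antisymm (range_codePoints_subset h.symm.subset))⟩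

/-! ### Borel dependence on the sequence, and the reduction -/

lemma measurable_codeDigits (k i : ℕ) : Measurable fun x => codeDigits x k i := by
  rcases k with _ | _ | k <;> rcases i with _ | _ | i <;> simp only [codeDigits]
  case succ.succ.succ.succ =>
    exact (measurable_of_countable fun b : Bool => (b.toNat : ℤ)).comp
      ((measurable_pi_apply i).comp (measurable_pi_apply k))
  all_goals exact measurable_const

lemma measurable_coord_orbit (n : ℤ) (i : ℕ) : Measurable fun x =>
    splitOdometer.coord (codePoints x) i
      ((splitOdometer.shift (codePoints x) ^ n) (splitOdometer.point (codePoints x) 0 false)) := by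
  have hdig : ∀ (j : ℤ) (k l : ℕ), MeasurableSet {x | (j : ZMod (odometerModulus l)) =
      codePoints x k l} := fun j k l =>
    measurable_codeDigits k l (.of_discrete (s := {a : ℤ | (j : ZMod (odometerModulus l)) = a}))
  refine measurable_to_bool ?_
  unfold splitOdometer.coord
  rcases Denumerable.ofNat ((ℕ × ℕ) ⊕ (ℤ × ℕ)) i with a | p
  · have : ∀ x, splitOdometer.bit (z := codePoints x) (Sum.inl a)
        ((splitOdometer.shift (codePoints x) ^ n) (splitOdometer.point (codePoints x) 0 false)) =
        decide ((n : ZMod (odometerModulus a.1)) = a.2) := by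
      intro x
      simp [splitOdometer.bit, splitOdometer.shift_zpow, splitOdometer.point]
    simp only [this]
    exact measurable_const (measurableSet_singleton true)
  -- With free bits set to `false` one formula covers both cases: on a free bit there is no
  -- disagreement, so no `m` exists.
  · have : ∀ x, splitOdometer.bit (z := codePoints x) (Sum.inr p)
        ((splitOdometer.shift (codePoints x) ^ n) (splitOdometer.point (codePoints x) 0 false)) =
        true ↔ ∃ m, Even m ∧ ((p.1 + n : ℤ) : ZMod (odometerModulus m)) ≠ codePoints x p.2 m ∧
          ∀ l < m, ((p.1 + n : ℤ) : ZMod (odometerModulus l)) = codePoints x p.2 l := by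
      intro x
      simp only [splitOdometer.bit, splitOdometer.shift_zpow, splitOdometer.point, Sum.elim_inr,
        zero_add]
      split_ifs with h
      · simp only [false_iff]
        rintro ⟨m, -, hm, -⟩
        rw [zero_add] at h
        exact hm (congrFun h m)
      · simp only [firstParity, decide_eq_true_eq, Pi.sub_apply, sub_ne_zero, sub_eq_zero,
          Pi.intCast_apply]
    change MeasurableSet {x | _ = true}
    simp only [this, ofPred_exists]
    refine MeasurableSet.iUnion fun m => (MeasurableSet.const _).inter
      ((hdig _ _ _).compl.inter ?_)
    change MeasurableSet {x | _}
    simp only [ofPred_forall]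
    exact MeasurableSet.iInter fun l => MeasurableSet.iInter fun _ => hdig _ _ _

theorem exists_measurable_topConjugate_iff : ∃ f : (ℕ → ℕ → Bool) → CantorMinimalSystem,
    Measurable f ∧ ∀ x y, range x = range y ↔ TopConjugate (f x).1 (f y).1 := by
  obtain ⟨f, hf, h⟩ := exists_measurable_realization
    (fun x : ℕ → ℕ → Bool => splitOdometer (codePoints x))
    (fun x => splitOdometer.shift (codePoints x))
    (fun x => splitOdometer.point (codePoints x) 0 false)
    (fun x => splitOdometer.coord (codePoints x)) (fun x i => splitOdometer.continuous_bit _)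
    (fun x => splitOdometer.coord_injective)
    (fun x => splitOdometer.cellsNontrivial_coord (separated_codePoints x))
    (fun x => splitOdometer.isMinimalHomeo_shift (separated_codePoints x))
    (fun x => splitOdometer.dense_orbit (separated_codePoints x) _) measurable_coord_orbit
  refine ⟨f, hf, fun x y => ?_⟩
  rw [← topConjugate_shift_codePoints_iff]
  exact ⟨fun k => (h x).symm.trans (k.trans (h y)), fun k => (h x).trans (k.trans (h y).symm)⟩

lemma friedmanStanleyJump_identityRelation_iff {X : Type*} (x y : ℕ → X) :
    friedmanStanleyJump (identityRelation X) x y ↔ range x = range y := by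
  have hinj : Function.Injective (Quotient.mk (identityRelation X)) := fun _ _ h =>
    Quotient.exact h
  change range (Quotient.mk (identityRelation X) ∘ x) =
    range (Quotient.mk (identityRelation X) ∘ y) ↔ _
  rw [range_comp, range_comp, hinj.image_injective.eq_iff]

theorem theorem1p1 :
    BorelReducible (friedmanStanleyJump (identityRelation ℝ)) CantorMinimalSystem.conjugacy := by
  -- A Borel injection of the reals into the Cantor space suffices, since it preserves and reflects
  -- equality of ranges.
  obtain ⟨b, hb, hbi⟩ := MeasurableSpace.measurable_injection_nat_bool_of_countablySeparated ℝ
  obtain ⟨f, hf, h⟩ := exists_measurable_topConjugate_iff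
  refine ⟨fun x => f fun n => b (x n),
    hf.comp (measurable_pi_lambda _ fun n => hb.comp (measurable_pi_apply n)), fun x y => ?_⟩
  rw [friedmanStanleyJump_identityRelation_iff]
  refine Iff.trans ?_ (h _ _)
  change _ ↔ range (b ∘ x) = range (b ∘ y)
  rw [range_comp, range_comp, hbi.image_injective.eq_iff]
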